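/- For integers $m\ge 2$, $n,P\ge 1$, a single-track Gray code of length $n$ and period $P$ over $\mathbb{Z}_m$ is a cyclic list $W_0,\dots,W_{P-1}$ of $P$ distinct words of length $n$ over $\mathbb{Z}_m$ such that any two cyclically consecutive words (including the last and the first) differ in exactly one position, and such that each column of the $P\times n$ array with rows $W_0,\dots,W_{P-1}$ is a cyclic shift of its first column. Let $p$ be an odd prime and $t\ge 1$. Then there exists a single-track Gray code of length $p^t$ and period $p^{p^t}$ over $\mathbb{Z}_p$. Every such code contains each word of length $p^t$ over $\mathbb{Z}_p$ exactly once, and $p^{p^t}$ is the maximum possible period: every single-track Gray code of length $p^t$ over $\mathbb{Z}_p$ has period at most $p^{p^t}$. -/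

import Mathlib

/-- `W` is a single-track Gray code of length `n` and period `P` over the alphabet `ℤ_m`: a
cyclically indexed list of `P` words of length `n`. -/
structure IsSingleTrackGrayCode (m n P : ℕ) (W : ZMod P → Fin n → ZMod m) : Prop where
  /-- The period is positive, so that `ZMod P` has exactly `P` elements. -/
  period_pos : 0 < P
  /-- The `P` words are distinct. -/
  distinct : Function.Injective W
  /-- Cyclically consecutive words differ in exactly one position. -/
  gray : ∀ j : ZMod P, ∃! i : Fin n, W j i ≠ W (j + 1) i
  /-- Every column of the `P × n` array is a cyclic shift of the first column. -/
  single_track : ∀ i : Fin n, ∃ k : ZMod P, ∀ j : ZMod P, W j i = W (j + k) ⟨0, i.pos⟩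

open Polynomial

section Track

variable {p : ℕ} [Fact p.Prime]

/-- `a` and `b` agree modulo `(X - 1) ^ J` up to multiplication by powers of `X`. -/
def ShiftRel (J : ℕ) (a b : (ZMod p)[X]) : Prop :=
  ∃ d e : ℕ, (X - 1) ^ J ∣ X ^ d * a - X ^ e * b

theorem ShiftRel.symm {J : ℕ} {a b : (ZMod p)[X]} (h : ShiftRel J a b) : ShiftRel J b a := by
  obtain ⟨d, e, h⟩ := h
  exact ⟨e, d, (dvd_sub_comm).1 h⟩

theorem ShiftRel.trans {J : ℕ} {a b c : (ZMod p)[X]} (h : ShiftRel J a b) (h' : ShiftRel J b c) :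
    ShiftRel J a c := by
  obtain ⟨d, e, q, h⟩ := h
  obtain ⟨d', e', q', h'⟩ := h'
  exact ⟨d' + d, e + e', X ^ d' * q + X ^ e * q', by
    rw [pow_add, pow_add]; linear_combination X ^ d' * h + X ^ e * h'⟩

theorem ShiftRel.of_le {J K : ℕ} (hJK : J ≤ K) {a b : (ZMod p)[X]} (h : ShiftRel K a b) :
    ShiftRel J a b := by
  obtain ⟨d, e, h⟩ := h
  exact ⟨d, e, (pow_dvd_pow _ hJK).trans h⟩

theorem shiftRel_affine {J : ℕ} (a v : (ZMod p)[X]) (e : ℕ) (hv : (X - 1) ^ J ∣ v) :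
    ShiftRel J a (X ^ e * a + v) := by
  refine ⟨e, 0, ?_⟩
  rw [show X ^ e * a - X ^ 0 * (X ^ e * a + v) = -v by ring]
  exact (dvd_neg).2 hv

theorem X_sub_one_dvd_iff (a : (ZMod p)[X]) : (X - 1) ∣ a ↔ a.eval 1 = 0 := by
  have := dvd_iff_isRoot (p := a) (a := (1 : ZMod p))
  simpa using this

theorem X_sub_one_ne_zero : (X - 1 : (ZMod p)[X]) ≠ 0 := by
  have := X_sub_C_ne_zero (1 : ZMod p)
  simpa using this

theorem X_sub_one_prime : Prime (X - 1 : (ZMod p)[X]) := by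
  have := prime_X_sub_C (1 : ZMod p)
  simpa using this

theorem X_pow_prime_pow_sub_one (s : ℕ) :
    (X ^ p ^ s - 1 : (ZMod p)[X]) = (X - 1) ^ p ^ s := by
  rw [sub_pow_char_pow, one_pow]

/-- The multiplicity of the root `1` of `X ^ d - 1` is the largest power of `p` dividing `d`. -/
theorem exists_dvd_of_pow_dvd_X_pow_sub_one {J d : ℕ} (hd : d ≠ 0)
    (h : (X - 1 : (ZMod p)[X]) ^ J ∣ X ^ d - 1) : ∃ v, p ^ v ∣ d ∧ J ≤ p ^ v := by
  have hp : p.Prime := Fact.out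
  obtain ⟨v, m, hm, rfl⟩ := Nat.exists_eq_pow_mul_and_not_dvd hd p hp.ne_one
  refine ⟨v, dvd_mul_right _ _, ?_⟩
  have hgeom : (X ^ m - 1 : (ZMod p)[X]) = (X - 1) * ∑ i ∈ Finset.range m, X ^ i := by
    rw [mul_comm, geom_sum_mul]
  have hX : (X ^ (p ^ v * m) - 1 : (ZMod p)[X])
      = (X - 1) ^ p ^ v * (∑ i ∈ Finset.range m, X ^ i) ^ p ^ v := by
    rw [← mul_pow, ← hgeom, sub_pow_char_pow, one_pow, ← pow_mul, mul_comm]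
  by_contra hlt
  push Not at hlt
  rw [hX] at h
  have h1 : (X - 1 : (ZMod p)[X]) ^ p ^ v * (X - 1)
      ∣ (X - 1) ^ p ^ v * (∑ i ∈ Finset.range m, X ^ i) ^ p ^ v :=
    (by rw [← pow_succ]; exact (pow_dvd_pow _ hlt).trans h)
  have h2 := X_sub_one_prime.dvd_of_dvd_pow
    ((mul_dvd_mul_iff_left (pow_ne_zero _ X_sub_one_ne_zero)).1 h1)
  rw [X_sub_one_dvd_iff] at h2
  simp [eval_finsetSum] at h2
  exact hm ((ZMod.natCast_eq_zero_iff _ _).1 h2)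

theorem X_sub_one_pow_dvd_of_dvd_mul {J : ℕ} {a u : (ZMod p)[X]} (hu : u.eval 1 = 1)
    (h : (X - 1) ^ J ∣ a * u) : (X - 1) ^ J ∣ a :=
  X_sub_one_prime.pow_dvd_of_dvd_mul_right J
    (fun h' => by rw [X_sub_one_dvd_iff, hu] at h'; exact one_ne_zero h') h

theorem exists_dvd_of_pow_dvd_shift_sub {J d e : ℕ} (hde : d ≠ e) {u : (ZMod p)[X]}
    (hu : u.eval 1 = 1) (h : (X - 1) ^ J ∣ X ^ d * u - X ^ e * u) :
    ∃ v, (p ^ v : ℤ) ∣ (d : ℤ) - e ∧ J ≤ p ^ v := by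
  wlog hlt : e < d generalizing d e
  · obtain ⟨v, h1, h2⟩ := this hde.symm ((dvd_sub_comm).1 h) (by omega)
    exact ⟨v, (dvd_sub_comm).1 h1, h2⟩
  obtain ⟨c, rfl⟩ := Nat.exists_eq_add_of_le hlt.le
  rw [show X ^ (e + c) * u - X ^ e * u = (X ^ c - 1) * (X ^ e * u) by ring] at h
  obtain ⟨v, h1, h2⟩ := exists_dvd_of_pow_dvd_X_pow_sub_one (by omega)
    (X_sub_one_pow_dvd_of_dvd_mul (by simp [hu]) h)
  exact ⟨v, by push_cast; simpa using (by exact_mod_cast h1 : ((p ^ v : ℕ) : ℤ) ∣ c), h2⟩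

theorem pow_succ_dvd_shift_sub {J d e : ℕ} (hJ : ¬ ∃ s, J = p ^ s) {u : (ZMod p)[X]}
    (hu : u.eval 1 = 1) (h : (X - 1) ^ J ∣ X ^ d * u - X ^ e * u) :
    (X - 1) ^ (J + 1) ∣ X ^ d * u - X ^ e * u := by
  wlog hlt : e ≤ d generalizing d e
  · exact (dvd_sub_comm).1 (this ((dvd_sub_comm).1 h) (by omega))
  rcases hlt.eq_or_lt with rfl | hlt
  · simp
  obtain ⟨v, ⟨c, hc⟩, hv⟩ := exists_dvd_of_pow_dvd_shift_sub (by omega) hu h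
  have hc0 : 0 ≤ c := by
    by_contra hneg
    have : (p ^ v : ℤ) * c ≤ 0 := mul_nonpos_of_nonneg_of_nonpos (by positivity) (by omega)
    omega
  lift c to ℕ using hc0
  have hd : d = e + p ^ v * c := by zify; linarith
  have hv' : J + 1 ≤ p ^ v := lt_of_le_of_ne hv fun h => hJ ⟨v, h⟩
  have h1 : (X - 1 : (ZMod p)[X]) ^ p ^ v ∣ X ^ (p ^ v * c) - 1 := by
    rw [← X_pow_prime_pow_sub_one, pow_mul]
    simpa using sub_dvd_pow_sub_pow (X ^ p ^ v : (ZMod p)[X]) 1 c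
  rw [hd, show X ^ (e + p ^ v * c) * u - X ^ e * u = (X ^ (p ^ v * c) - 1) * (X ^ e * u) by ring]
  exact ((pow_dvd_pow _ hv').trans h1).mul_right _

/-- A path `u 0, …, u N` whose steps are `c (X - 1) X ^ i`, which is closed and without repetition
in the quotient by `ShiftRel J`. -/
structure IsTrack (J N : ℕ) (u : ℕ → (ZMod p)[X]) : Prop where
  pos : 0 < N
  step : ∀ k < N, ∃ c : ZMod p, c ≠ 0 ∧ ∃ i : ℕ, u (k + 1) = u k + C c * (X - 1) * X ^ i
  inj : ∀ k < N, ∀ l < N, ShiftRel J (u k) (u l) → k = l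
  closed : ∃ b : ℕ, (X - 1) ^ J ∣ u N - X ^ b * u 0

/-- Replacing the step from `u k` by one with an equivalent endpoint. -/
theorem IsTrack.alter {J N : ℕ} {u : ℕ → (ZMod p)[X]} (hu : IsTrack J N u) {k : ℕ} (hk : k < N)
    (a : ℕ) {v : (ZMod p)[X]} (hv : (X - 1) ^ J ∣ v) {c : ZMod p} (hc : c ≠ 0) {i : ℕ}
    (hstep : X ^ a * u (k + 1) + v = u k + C c * (X - 1) * X ^ i) :
    IsTrack J N (fun m => if m ≤ k then u m else X ^ a * u m + v) := by
  have hrel : ∀ m, ShiftRel J (u m) ((fun m => if m ≤ k then u m else X ^ a * u m + v) m) := by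
    intro m
    dsimp only
    split_ifs
    · exact ⟨0, 0, by simp⟩
    · exact shiftRel_affine _ _ _ hv
  refine ⟨hu.pos, fun m hm => ?_, fun m hm l hl h => ?_, ?_⟩
  · rcases lt_trichotomy m k with h | rfl | h
    · simpa only [show m + 1 ≤ k from h, h.le, if_true] using hu.step m hm
    · exact ⟨c, hc, i, by simpa using hstep⟩
    · obtain ⟨c', hc', i', h'⟩ := hu.step m hm
      refine ⟨c', hc', a + i', ?_⟩
      simp only [show ¬ m + 1 ≤ k by omega, show ¬ m ≤ k by omega, if_false, h']
      ring
  · exact hu.inj m hm l hl (((hrel m).trans h).trans (hrel l).symm)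
  · obtain ⟨b, q, hb⟩ := hu.closed
    obtain ⟨w, rfl⟩ := hv
    refine ⟨a + b, X ^ a * q + w, ?_⟩
    simp only [show ¬ N ≤ k by omega, if_false, zero_le, if_true]
    linear_combination X ^ a * hb

theorem IsTrack.eval_one {J N : ℕ} {u : ℕ → (ZMod p)[X]} (hu : IsTrack J N u)
    (h0 : (u 0).eval 1 = 1) : ∀ k ≤ N, (u k).eval 1 = 1 := by
  intro k hk
  induction k with
  | zero => exact h0
  | succ k ih =>
    obtain ⟨c, -, i, h⟩ := hu.step k hk
    simp [h, ih (by omega)]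

theorem iterate_affine_dvd {J b : ℕ} {Z : (ZMod p)[X]} (hZ : (X - 1) ^ J ∣ Z) (q : ℕ)
    (a : (ZMod p)[X]) :
    (X - 1) ^ (J + 1) ∣ (fun a => X ^ b * a + Z)^[q] a - (X ^ (b * q) * a + (q : (ZMod p)[X]) * Z) := by
  induction q with
  | zero => simp
  | succ q ih =>
    rw [Function.iterate_succ_apply']
    obtain ⟨r, hr⟩ := ih
    obtain ⟨w, rfl⟩ := hZ
    obtain ⟨s, hs⟩ : (X - 1 : (ZMod p)[X]) ∣ X ^ b - 1 := by simp [X_sub_one_dvd_iff]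
    refine ⟨X ^ b * r + (q : (ZMod p)[X]) * w * s, ?_⟩
    push_cast
    rw [mul_add b q 1, pow_add, mul_one]
    linear_combination X ^ b * hr + (q : (ZMod p)[X]) * (X - 1) ^ J * w * hs

/-- The periodic continuation of a path by an affine map. -/
def affineExtend (N : ℕ) (ψ : (ZMod p)[X] → (ZMod p)[X]) (u : ℕ → (ZMod p)[X]) (k : ℕ) :
    (ZMod p)[X] :=
  ψ^[k / N] (u (k % N))

theorem affineExtend_apply {N : ℕ} (hN : 0 < N) {ψ : (ZMod p)[X] → (ZMod p)[X]}
    {u : ℕ → (ZMod p)[X]} (h : u N = ψ (u 0)) (q : ℕ) {m : ℕ} (hm : m ≤ N) :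
    affineExtend N ψ u (q * N + m) = ψ^[q] (u m) := by
  unfold affineExtend
  rcases hm.lt_or_eq with hm | rfl
  · rw [Nat.mul_add_mod', Nat.mod_eq_of_lt hm, add_comm, Nat.add_mul_div_right _ _ hN, Nat.div_eq_of_lt hm,
      zero_add]
  · rw [← Nat.succ_mul, Nat.mul_mod_left, Nat.mul_div_cancel _ hN, Function.iterate_succ_apply, h]

theorem IsTrack.lift {J N b : ℕ} {u : ℕ → (ZMod p)[X]} (hu : IsTrack J N u)
    (hJ : ¬ ∃ s, J = p ^ s) (h0 : (u 0).eval 1 = 1) {Z : (ZMod p)[X]}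
    (hN : u N = X ^ b * u 0 + Z) (hZ : (X - 1) ^ J ∣ Z) (hZ' : ¬ (X - 1) ^ (J + 1) ∣ Z) :
    IsTrack (J + 1) (p * N) (affineExtend N (fun a => X ^ b * a + Z) u) := by
  have hp : p.Prime := Fact.out
  have hpos := hu.pos
  set ψ : (ZMod p)[X] → (ZMod p)[X] := fun a => X ^ b * a + Z with hψ
  have happ : ∀ q m, m ≤ N → affineExtend N ψ u (q * N + m) = ψ^[q] (u m) :=
    fun q m hm => affineExtend_apply hpos hN q hm
  have hdecomp : ∀ k < p * N, k / N < p ∧ k % N < N ∧ k = k / N * N + k % N := fun k hk =>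
    ⟨(Nat.div_lt_iff_lt_mul hpos).2 hk, Nat.mod_lt _ hpos, (Nat.div_add_mod' k N).symm⟩
  refine ⟨Nat.mul_pos hp.pos hpos, fun k hk => ?_, fun k hk l hl h => ?_, ?_⟩
  · obtain ⟨-, hm, hkm⟩ := hdecomp k hk
    generalize k / N = q at hkm
    generalize k % N = m at hkm hm
    subst hkm
    rw [add_assoc, happ _ _ (by omega), happ _ _ hm.le]
    obtain ⟨c, hc, i, hs⟩ := hu.step m hm
    refine ⟨c, hc, b * q + i, ?_⟩
    rw [hs]
    clear hk
    induction q with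
    | zero => simp
    | succ q ih =>
      rw [Function.iterate_succ_apply', Function.iterate_succ_apply', ih]
      simp only [hψ]
      ring
  · obtain ⟨hq, hm, hkm⟩ := hdecomp k hk
    obtain ⟨hq', hm', hlm⟩ := hdecomp l hl
    generalize k / N = q at *
    generalize k % N = m at *
    generalize l / N = q' at *
    generalize l % N = m' at *
    subst hkm hlm
    rw [happ _ _ hm.le, happ _ _ hm'.le] at h
    have key : ∀ q m, ShiftRel J (u m) (ψ^[q] (u m)) := by
      intro q m
      obtain ⟨r, hr⟩ := (pow_dvd_pow _ (Nat.le_succ J)).trans (iterate_affine_dvd (b := b) hZ q (u m))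
      obtain ⟨w, hw⟩ := hZ
      refine ⟨b * q, 0, -(r + (q : (ZMod p)[X]) * w), ?_⟩
      linear_combination - hr - (q : (ZMod p)[X]) * hw
    obtain rfl : m = m' := hu.inj m hm m' hm' (((key q m).trans (h.of_le (Nat.le_succ J))).trans
      (key q' m').symm)
    obtain ⟨d, e, h⟩ := h
    have hum := hu.eval_one h0 m hm.le
    have hX : ∀ d : ℕ, (X - 1 : (ZMod p)[X]) ^ (J + 1) ∣ (X ^ d - 1) * Z := by
      intro d
      rw [pow_succ']
      exact mul_dvd_mul (by simp [X_sub_one_dvd_iff]) hZ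
    have e1 := iterate_affine_dvd (b := b) hZ q (u m)
    have e2 := iterate_affine_dvd (b := b) hZ q' (u m)
    rw [← hψ] at e1 e2
    have h3 : (X - 1 : (ZMod p)[X]) ^ (J + 1) ∣ (X ^ (d + b * q) * u m - X ^ (e + b * q') * u m)
        + ((q : (ZMod p)[X]) - (q' : (ZMod p)[X])) * Z := by
      have := (((h.sub (e1.mul_left (X ^ d))).add (e2.mul_left (X ^ e))).sub
        ((hX d).mul_left (q : (ZMod p)[X]))).add ((hX e).mul_left (q' : (ZMod p)[X]))
      convert this using 1
      ring
    have h4 : (X - 1 : (ZMod p)[X]) ^ J ∣ X ^ (d + b * q) * u m - X ^ (e + b * q') * u m := by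
      have := ((pow_dvd_pow _ (Nat.le_succ J)).trans h3).sub (hZ.mul_left ((q : (ZMod p)[X]) - (q' : (ZMod p)[X])))
      simpa using this
    have h5 := (dvd_add_right (pow_succ_dvd_shift_sub hJ hum h4)).1 h3
    have hqq : (q : ZMod p) - q' = 0 := by
      by_contra hne
      apply hZ'
      have h6 := h5.mul_left (C ((q : ZMod p) - q')⁻¹)
      rwa [← mul_assoc, ← C_eq_natCast, ← C_eq_natCast, ← C_sub, ← C_mul, inv_mul_cancel₀ hne, C_1,
        one_mul] at h6
    rw [sub_eq_zero, ZMod.natCast_eq_natCast_iff', Nat.mod_eq_of_lt hq, Nat.mod_eq_of_lt hq'] at hqq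
    rw [hqq]
  · refine ⟨b * p, ?_⟩
    have h1 := happ p 0 (Nat.zero_le _)
    have h2 := happ 0 0 (Nat.zero_le _)
    simp only [add_zero, zero_mul, Function.iterate_zero_apply] at h1 h2
    rw [h1, h2]
    simpa using iterate_affine_dvd (b := b) hZ p (u 0)

end Track

section Tower

variable {p : ℕ} [Fact p.Prime]

/-- A track starting at `2 - X`, `1`, with as many points as there are classes modulo
`ShiftRel (j + 1)`, that passes through a translate of its first step unless `j` is a power
of `p`. -/
structure IsForkedTrack (j N : ℕ) (u : ℕ → (ZMod p)[X]) : Prop extends IsTrack (j + 1) N u where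
  zero : u 0 = 2 - X
  one : u 1 = 1
  card : N * p ^ (Nat.log p j + 1) = p ^ j
  fork : (¬ ∃ s, j = p ^ s) → ∃ k, 1 ≤ k ∧ k < N ∧ ∃ (b : ℕ) (φ : (ZMod p)[X]),
    (X - 1) ^ j ∣ φ ∧ ¬ (X - 1) ^ (j + 1) ∣ φ ∧ u k = X ^ b * u 0 + φ ∧ u (k + 1) = X ^ b * u 1 + φ

theorem log_succ_of_not_pow {j : ℕ} (hj : j ≠ 0) (h : ¬ ∃ s, j + 1 = p ^ s) :
    Nat.log p (j + 1) = Nat.log p j := by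
  have hp : p.Prime := Fact.out
  refine Nat.log_eq_of_pow_le_of_lt_pow
    ((Nat.pow_log_le_self p hj).trans (Nat.le_succ j)) ?_
  exact lt_of_le_of_ne (Nat.lt_pow_succ_log_self hp.one_lt j) fun h' => h ⟨_, h'⟩

theorem log_pred_pow {j s : ℕ} (h : j + 1 = p ^ (s + 1)) : Nat.log p j = s := by
  have hp : p.Prime := Fact.out
  refine Nat.log_eq_of_pow_le_of_lt_pow ?_ (by omega)
  have : p ^ s < p ^ (s + 1) := Nat.pow_lt_pow_right hp.one_lt (Nat.lt_succ_self s)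
  omega

theorem IsTrack.lift_forked {j N b : ℕ} (hj : j ≠ 0) {u : ℕ → (ZMod p)[X]}
    (hu : IsTrack (j + 1) N u) (hpow : ¬ ∃ s, j + 1 = p ^ s) (h0 : u 0 = 2 - X) (h1 : u 1 = 1)
    (hcard : N * p ^ (Nat.log p j + 1) = p ^ j) {Z : (ZMod p)[X]}
    (hN : u N = X ^ b * u 0 + Z) (hZ : (X - 1) ^ (j + 1) ∣ Z) (hZ' : ¬ (X - 1) ^ (j + 2) ∣ Z) :
    ∃ u' : ℕ → (ZMod p)[X], IsForkedTrack (j + 1) (p * N) u' := by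
  have hp : p.Prime := Fact.out
  have hpos := hu.pos
  have happ := fun q m => affineExtend_apply (p := p) (m := m) hpos
    (ψ := fun a => X ^ b * a + Z) (u := u) hN q
  have e0 := happ 0 0 (Nat.zero_le _)
  have e1 := happ 0 1 hpos
  have e2 := happ 1 0 (Nat.zero_le _)
  have e3 := happ 1 1 hpos
  simp only [zero_mul, zero_add, one_mul, add_zero, Function.iterate_zero_apply,
    Function.iterate_one] at e0 e1 e2 e3
  refine ⟨affineExtend N (fun a => X ^ b * a + Z) u,
    hu.lift hpow (by rw [h0]; norm_num) hN hZ hZ', by rw [e0, h0], by rw [e1, h1], ?_, fun _ => ?_⟩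
  · rw [log_succ_of_not_pow hj hpow, mul_assoc, hcard, pow_succ']
  · refine ⟨N, hpos, ?_, b, Z, hZ, hZ', ?_, ?_⟩
    · have := hp.two_le
      nlinarith
    · rw [e2, e0]
    · rw [e3, e1]

theorem not_pow_succ_dvd_mul {J : ℕ} {a : (ZMod p)[X]} (ha : a.eval 1 ≠ 0) :
    ¬ (X - 1) ^ (J + 1) ∣ (X - 1) ^ J * a := by
  rw [pow_succ, mul_dvd_mul_iff_left (pow_ne_zero _ X_sub_one_ne_zero), X_sub_one_dvd_iff]
  exact ha

theorem IsForkedTrack.jump {j N : ℕ} (hj : j ≠ 0) {u : ℕ → (ZMod p)[X]}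
    (hu : IsForkedTrack j N u) {s : ℕ} (hs : j + 1 = p ^ s) : IsForkedTrack (j + 1) N u := by
  have hp : p.Prime := Fact.out
  refine ⟨⟨hu.pos, hu.step, fun k hk l hl h => hu.inj k hk l hl (h.of_le (Nat.le_succ _)), ?_⟩,
    hu.zero, hu.one, ?_, fun h => (h ⟨s, hs⟩).elim⟩
  · obtain ⟨b, Z, hb⟩ := hu.closed
    obtain ⟨r, hr⟩ : ∃ r : ℕ, (r : ZMod p) = Z.eval 1 := ⟨_, ZMod.natCast_zmod_val _⟩
    obtain ⟨c, hc⟩ : (X - 1 : (ZMod p)[X]) ∣ Z - (r : (ZMod p)[X]) * (X ^ b * u 0) := by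
      rw [X_sub_one_dvd_iff, hu.zero]
      norm_num [hr]
    have hpw : (X ^ p ^ s : (ZMod p)[X]) = 1 + (X - 1) ^ (j + 1) := by
      rw [hs, ← X_pow_prime_pow_sub_one]; ring
    obtain ⟨w, hw⟩ : ∃ w : (ZMod p)[X], (1 + (X - 1) ^ (j + 1)) ^ r
        = 1 + (r : (ZMod p)[X]) * (X - 1) ^ (j + 1) + (X - 1) ^ (j + 2) * w := by
      clear hc hr
      induction r with
      | zero => exact ⟨0, by simp⟩
      | succ r ih =>
        obtain ⟨w, hw⟩ := ih
        refine ⟨w * (1 + (X - 1) ^ (j + 1)) + (r : (ZMod p)[X]) * (X - 1) ^ j, ?_⟩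
        rw [pow_succ, hw]
        push_cast
        ring
    refine ⟨b + p ^ s * r, c - X ^ b * w * u 0, ?_⟩
    rw [pow_add, pow_mul, hpw, hw]
    linear_combination hb + (X - 1) ^ (j + 1) * hc
  · obtain _ | s := s
    · rw [pow_zero] at hs; omega
    rw [hs, Nat.log_pow hp.one_lt, ← hs, pow_succ p j, ← hu.card, log_pred_pow hs]
    ring

theorem IsForkedTrack.two_le {j N : ℕ} (hp2 : p ≠ 2) (hj : 2 ≤ j) {u : ℕ → (ZMod p)[X]}
    (hu : IsForkedTrack j N u) : 2 ≤ N := by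
  have hp : p.Prime := Fact.out
  have hp3 : 3 ≤ p := by have := hp.two_le; omega
  by_contra h
  obtain rfl : N = 1 := by have := hu.pos; omega
  have hc := hu.card
  rw [one_mul] at hc
  have h1 := Nat.pow_right_injective hp.two_le hc
  have h2 := Nat.pow_log_le_self p (x := j) (by omega)
  generalize Nat.log p j = l at *
  have h3 : 1 + l * 2 ≤ 3 ^ l := by
    clear h1 h2 hc
    induction l with
    | zero => simp
    | succ l ih => rw [pow_succ]; omega
  have h4 : 3 ^ l ≤ p ^ l := Nat.pow_le_pow_left hp3 l
  omega

theorem IsForkedTrack.succ {j N : ℕ} (hp2 : p ≠ 2) (hj : 2 ≤ j) {u : ℕ → (ZMod p)[X]}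
    (hu : IsForkedTrack j N u) : ∃ (N' : ℕ) (u' : ℕ → (ZMod p)[X]), IsForkedTrack (j + 1) N' u' := by
  have hp : p.Prime := Fact.out
  have h20 : (2 : ZMod p) ≠ 0 := by
    intro h
    have := (ZMod.natCast_eq_zero_iff 2 p).1 (by exact_mod_cast h)
    exact hp2 ((Nat.prime_dvd_prime_iff_eq hp Nat.prime_two).1 this)
  by_cases hpow : ∃ s, j + 1 = p ^ s
  · obtain ⟨s, hs⟩ := hpow
    exact ⟨N, u, hu.jump (by omega) hs⟩
  refine ⟨p * N, ?_⟩
  obtain ⟨b, hb⟩ := hu.closed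
  have hN : u N = X ^ b * u 0 + (u N - X ^ b * u 0) := by ring
  generalize u N - X ^ b * u 0 = Z at hb hN
  by_cases hZ : (X - 1) ^ (j + 2) ∣ Z
  swap
  · exact hu.lift_forked (by omega) hpow hu.zero hu.one hu.card hN hb hZ
  -- The closing defect of a suitably altered track has multiplicity exactly `j + 1`.
  suffices h : ∃ k, 1 ≤ k ∧ k < N ∧ ∃ (a : ℕ) (v : (ZMod p)[X]) (c : ZMod p) (i : ℕ),
      (X - 1) ^ (j + 1) ∣ v ∧ ¬ (X - 1) ^ (j + 2) ∣ v ∧ c ≠ 0 ∧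
      X ^ a * u (k + 1) + v = u k + C c * (X - 1) * X ^ i by
    obtain ⟨k, hk1, hkN, a, v, c, i, hv, hv', hc, hstep⟩ := h
    refine (hu.alter hkN a hv hc hstep).lift_forked (by omega) hpow (b := a + b)
      (Z := X ^ a * Z + v) ?_ ?_ hu.card ?_ ((hb.mul_left _).add hv) fun h => hv' ?_
    · simp [hu.zero]
    · simp [hu.one, hk1]
    · simp only [show ¬ N ≤ k by omega, if_false, zero_le, if_true, hN]
      ring
    · exact (dvd_add_right (hZ.mul_left _)).1 h
  by_cases hjpow : ∃ s, j = p ^ s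
  · obtain ⟨s, hs⟩ := hjpow
    have hN2 := hu.two_le hp2 hj
    obtain ⟨c, hc, i, h⟩ := hu.step 1 (by omega)
    refine ⟨1, le_rfl, by omega, 0, (X - 1) ^ (j + 1) * (C c * X ^ i), c, i + p ^ s,
      dvd_mul_right _ _, not_pow_succ_dvd_mul (by simpa using hc), hc, ?_⟩
    have hpw : (X ^ p ^ s : (ZMod p)[X]) = 1 + (X - 1) ^ j := by
      rw [hs, ← X_pow_prime_pow_sub_one]; ring
    rw [h, pow_add X i, hpw]
    ring
  · obtain ⟨k, hk1, hkN, b', φ, hφ, hφ', h1, h2⟩ := hu.fork hjpow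
    refine ⟨k, hk1, hkN, 1, -((X - 1) * φ), 2, b', ?_, ?_, h20, ?_⟩
    · rw [dvd_neg, pow_succ']
      exact mul_dvd_mul_left _ hφ
    · rw [dvd_neg, pow_succ', mul_dvd_mul_iff_left X_sub_one_ne_zero]
      exact hφ'
    · rw [h1, h2, hu.zero, hu.one, C_ofNat]
      ring

theorem exists_isForkedTrack (hp2 : p ≠ 2) (j : ℕ) (hj : 2 ≤ j) :
    ∃ (N : ℕ) (u : ℕ → (ZMod p)[X]), IsForkedTrack j N u := by
  have hp : p.Prime := Fact.out
  induction j, hj using Nat.le_induction with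
  | base =>
    have hZ : (1 : (ZMod p)[X]) = X ^ 1 * (2 - X) + (X - 1) ^ 2 := by ring
    have ht : IsTrack (1 + 1) 1 (fun k => if k = 0 then 2 - X else (1 : (ZMod p)[X])) := by
      refine ⟨one_pos, fun k hk => ⟨1, one_ne_zero, 0, ?_⟩, fun k hk l hl _ => by omega, 1, ?_⟩
      · obtain rfl : k = 0 := by omega
        simp
        ring
      · simp only [one_ne_zero, if_false, if_true]
        exact ⟨1, by ring⟩
    have hpow : ¬ ∃ s, 1 + 1 = p ^ s := by
      rintro ⟨s, hs⟩
      have : p ∣ 2 := by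
        rw [show (2 : ℕ) = p ^ s from hs]
        exact dvd_pow_self p (by rintro rfl; simp at hs)
      exact hp2 ((Nat.prime_dvd_prime_iff_eq hp Nat.prime_two).1 this)
    refine ⟨p * 1, ht.lift_forked one_ne_zero hpow ?_ ?_ ?_ (b := 1) (Z := (X - 1) ^ 2) ?_ dvd_rfl ?_⟩
    · simp
    · simp
    · simp
    · simpa using hZ
    · simpa using not_pow_succ_dvd_mul (p := p) (J := 2) (a := 1) (by simp)
  | succ j hj ih =>
    obtain ⟨N, u, hu⟩ := ih
    exact hu.succ hp2 hj

end Tower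

section Words

variable {p : ℕ} [Fact p.Prime]

/-- The word of length `n` formed by the coefficients of `(u - 1) / (X - 1)` modulo `X ^ n - 1`. -/
noncomputable def trackWord (n : ℕ) (u : (ZMod p)[X]) (i : Fin n) : ZMod p :=
  (((u - 1) /ₘ (X - C 1)) %ₘ (X ^ n - 1)).coeff i

theorem trackWord_one_add_mul (n : ℕ) (g : (ZMod p)[X]) (i : Fin n) :
    trackWord n (1 + (X - 1) * g) i = (g %ₘ (X ^ n - 1)).coeff i := by
  unfold trackWord
  rw [add_sub_cancel_left, show (X - 1 : (ZMod p)[X]) = X - C 1 by simp,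
    mul_divByMonic_cancel_left _ (monic_X_sub_C 1)]

theorem exists_eq_one_add_mul {u : (ZMod p)[X]} (hu : u.eval 1 = 1) :
    ∃ g : (ZMod p)[X], u = 1 + (X - 1) * g := by
  obtain ⟨g, hg⟩ := (X_sub_one_dvd_iff (u - 1)).2 (by simp [hu])
  exact ⟨g, by linear_combination hg⟩

theorem monic_X_pow_sub_one {n : ℕ} (hn : n ≠ 0) : (X ^ n - 1 : (ZMod p)[X]).Monic := by
  simpa using monic_X_pow_sub_C (1 : ZMod p) hn

theorem degree_X_pow_sub_one {n : ℕ} (hn : n ≠ 0) : (X ^ n - 1 : (ZMod p)[X]).degree = n := by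
  simpa using degree_X_pow_sub_C (Nat.pos_of_ne_zero hn) (1 : ZMod p)

theorem trackWord_eq_iff (t : ℕ) {u v : (ZMod p)[X]} (hu : u.eval 1 = 1) (hv : v.eval 1 = 1) :
    trackWord (p ^ t) u = trackWord (p ^ t) v ↔ (X - 1) ^ (p ^ t + 1) ∣ u - v := by
  have hp : p.Prime := Fact.out
  have hn : p ^ t ≠ 0 := pow_ne_zero _ hp.ne_zero
  have hm := monic_X_pow_sub_one (p := p) hn
  obtain ⟨g, rfl⟩ := exists_eq_one_add_mul hu
  obtain ⟨f, rfl⟩ := exists_eq_one_add_mul hv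
  rw [show (1 + (X - 1) * g - (1 + (X - 1) * f) : (ZMod p)[X]) = (X - 1) * (g - f) by ring,
    pow_succ', mul_dvd_mul_iff_left X_sub_one_ne_zero, ← X_pow_prime_pow_sub_one,
    ← modByMonic_eq_zero_iff_dvd hm, sub_modByMonic, sub_eq_zero]
  constructor
  · intro h
    ext i
    by_cases hi : i < p ^ t
    · have := congrFun h ⟨i, hi⟩
      rwa [trackWord_one_add_mul, trackWord_one_add_mul] at this
    · have hdeg : ∀ g : (ZMod p)[X], (g %ₘ (X ^ p ^ t - 1)).coeff i = 0 := fun g =>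
        coeff_eq_zero_of_degree_lt ((degree_modByMonic_lt g hm).trans_le (by
          rw [degree_X_pow_sub_one hn]; exact_mod_cast not_lt.1 hi))
      rw [hdeg, hdeg]
  · intro h
    funext i
    rw [trackWord_one_add_mul, trackWord_one_add_mul, h]

theorem trackWord_add_step {n : ℕ} (hn : n ≠ 0) {u : (ZMod p)[X]} (hu : u.eval 1 = 1) (c : ZMod p)
    (i : ℕ) (l : Fin n) :
    trackWord n (u + C c * (X - 1) * X ^ i) l
      = trackWord n u l + if (l : ℕ) = i % n then c else 0 := by
  have hm := monic_X_pow_sub_one (p := p) hn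
  obtain ⟨g, rfl⟩ := exists_eq_one_add_mul hu
  rw [show (1 + (X - 1) * g + C c * (X - 1) * X ^ i : (ZMod p)[X])
    = 1 + (X - 1) * (g + C c * X ^ i) by ring, trackWord_one_add_mul, trackWord_one_add_mul,
    add_modByMonic, coeff_add]
  congr 1
  have h1 : (C c * X ^ i : (ZMod p)[X]) %ₘ (X ^ n - 1) = C c * X ^ (i % n) := by
    obtain ⟨q, hq⟩ : (X ^ n - 1 : (ZMod p)[X]) ∣ (X ^ n) ^ (i / n) - 1 := by
      simpa using sub_dvd_pow_sub_pow (X ^ n : (ZMod p)[X]) 1 (i / n)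
    refine (div_modByMonic_unique (C c * X ^ (i % n) * q) _ hm ⟨?_, ?_⟩).2
    · conv_rhs => rw [← Nat.mod_add_div i n, pow_add, pow_mul]
      linear_combination -C c * X ^ (i % n) * hq
    · rw [degree_X_pow_sub_one hn]
      exact (degree_C_mul_X_pow_le _ _).trans_lt (by exact_mod_cast Nat.mod_lt _ (by omega))
  rw [h1, coeff_C_mul_X_pow]

theorem trackWord_X_mul {n : ℕ} {u : (ZMod p)[X]} (hu : u.eval 1 = 1) (i : ℕ) (hi : i + 1 < n) :
    trackWord n (X * u) ⟨i + 1, hi⟩ = trackWord n u ⟨i, by omega⟩ := by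
  have hn : n ≠ 0 := by omega
  have hm := monic_X_pow_sub_one (p := p) hn
  obtain ⟨g, rfl⟩ := exists_eq_one_add_mul hu
  rw [show (X * (1 + (X - 1) * g) : (ZMod p)[X]) = 1 + (X - 1) * (X * g + 1) by ring,
    trackWord_one_add_mul, trackWord_one_add_mul]
  set r := g %ₘ (X ^ n - 1) with hr
  have hrn : ∀ k, n ≤ k → r.coeff k = 0 := fun k hk =>
    coeff_eq_zero_of_degree_lt ((degree_modByMonic_lt g hm).trans_le (by
      rw [degree_X_pow_sub_one hn]; exact_mod_cast hk))
  have hg := modByMonic_add_div g (X ^ n - 1)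
  rw [← hr] at hg
  set s : (ZMod p)[X] := X * r - C (r.coeff (n - 1)) * (X ^ n - 1) + 1 with hs
  have hcoeff : ∀ k, s.coeff (k + 1) = r.coeff k - if k + 1 = n then r.coeff (n - 1) else 0 := by
    intro k
    simp [hs, coeff_X_mul, coeff_one, coeff_X_pow, mul_sub]
  have h1 : (X * g + 1) %ₘ (X ^ n - 1) = s := by
    refine (div_modByMonic_unique (X * (g /ₘ (X ^ n - 1)) + C (r.coeff (n - 1))) s hm ⟨?_, ?_⟩).2
    · rw [hs]
      linear_combination X * hg
    · rw [degree_X_pow_sub_one hn, degree_lt_iff_coeff_zero]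
      intro k hk
      obtain _ | k := k
      · omega
      rw [hcoeff]
      split_ifs with h
      · rw [show n - 1 = k by omega, sub_self]
      · rw [hrn k (by omega), sub_zero]
  rw [h1]
  simp only
  rw [hcoeff, if_neg (by omega), sub_zero]

theorem trackWord_X_pow_mul {n : ℕ} {u : (ZMod p)[X]} (hu : u.eval 1 = 1) (i : ℕ) (hi : i < n) :
    trackWord n (X ^ i * u) ⟨i, hi⟩ = trackWord n u ⟨0, by omega⟩ := by
  induction i with
  | zero => simp
  | succ i ih =>
    rw [pow_succ', mul_assoc, trackWord_X_mul (by simp [hu]), ih]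

end Words

section Code

variable {p : ℕ} [Fact p.Prime]

/-- A closed track through all classes whose holonomy generates the group of shifts. -/
theorem exists_isTrack_not_dvd (hp2 : p ≠ 2) {n : ℕ} (hn : 2 ≤ n) :
    ∃ (N h : ℕ) (u : ℕ → (ZMod p)[X]), IsTrack (n + 1) N u ∧ (u 0).eval 1 = 1 ∧
      N * p ^ (Nat.log p n + 1) = p ^ n ∧ ¬ p ∣ h ∧ (X - 1) ^ (n + 1) ∣ u N - X ^ h * u 0 := by
  have hp : p.Prime := Fact.out
  obtain ⟨N, u, hu⟩ := exists_isForkedTrack (p := p) hp2 n hn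
  obtain ⟨h, hh⟩ := hu.closed
  have h0 : (u 0).eval 1 = 1 := by rw [hu.zero]; norm_num
  by_cases hdvd : p ∣ h
  swap
  · exact ⟨N, h, u, hu.toIsTrack, h0, hu.card, hdvd, hh⟩
  have h20 : (2 : ZMod p) ≠ 0 := by
    intro h
    have := (ZMod.natCast_eq_zero_iff 2 p).1 (by exact_mod_cast h)
    exact hp2 ((Nat.prime_dvd_prime_iff_eq hp Nat.prime_two).1 this)
  refine ⟨N, h + 1, _, hu.alter hu.pos 1 (v := 0) (dvd_zero _) h20 (i := 0) ?_, ?_, hu.card, ?_, ?_⟩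
  · rw [hu.zero, zero_add, hu.one, C_ofNat]
    ring
  · simpa using h0
  · intro h'
    exact hp.one_lt.ne' (Nat.dvd_one.1 ((Nat.dvd_add_right hdvd).1 h'))
  · obtain ⟨q, hq⟩ := hh
    have := hu.pos
    simp only [show ¬ N ≤ 0 by omega, if_false, le_refl, if_true]
    exact ⟨X * q, by linear_combination X * hq⟩

theorem exists_isSingleTrackGrayCode (hp2 : p ≠ 2) {t : ℕ} (ht : 1 ≤ t) :
    ∃ W : ZMod (p ^ p ^ t) → Fin (p ^ t) → ZMod p,
      IsSingleTrackGrayCode p (p ^ t) (p ^ p ^ t) W := by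
  have hp : p.Prime := Fact.out
  have hn2 : 2 ≤ p ^ t := hp.two_le.trans (Nat.le_self_pow (by omega) p)
  have hn0 : p ^ t ≠ 0 := by omega
  obtain ⟨N, h, u, hu, h0, hcard, hph, hclosed⟩ := exists_isTrack_not_dvd (p := p) hp2 hn2
  rw [Nat.log_pow hp.one_lt] at hcard
  have hN := hu.pos
  set P := p ^ p ^ t with hP
  have hP0 : 0 < P := pow_pos hp.pos _
  have : NeZero P := ⟨hP0.ne'⟩
  set G : ℕ → (ZMod p)[X] := fun k => X ^ (h * (k / N)) * u (k % N) with hG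
  have hG1 : ∀ k, (G k).eval 1 = 1 := fun k => by
    simp [hG, hu.eval_one h0 _ (Nat.mod_lt k hN).le]
  have hGq : ∀ k q, G (k + q * N) = X ^ (h * q) * G k := fun k q => by
    simp only [hG, Nat.add_mul_div_right _ _ hN, Nat.add_mul_mod_self_right]
    ring
  have hperX : ∀ (r : ℕ) (a : (ZMod p)[X]),
      (X - 1) ^ (p ^ t + 1) ∣ X ^ (p ^ (t + 1) * r) * a - a := by
    intro r a
    rw [show X ^ (p ^ (t + 1) * r) * a - a = (X ^ (p ^ (t + 1) * r) - 1) * a by ring]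
    refine Dvd.dvd.mul_right ?_ a
    have h1 : (X ^ p ^ (t + 1) - 1 : (ZMod p)[X]) ∣ X ^ (p ^ (t + 1) * r) - 1 := by
      rw [pow_mul]
      simpa using sub_dvd_pow_sub_pow (X ^ p ^ (t + 1) : (ZMod p)[X]) 1 r
    rw [X_pow_prime_pow_sub_one] at h1
    exact (pow_dvd_pow _ (Nat.pow_lt_pow_right hp.one_lt (Nat.lt_succ_self t))).trans h1
  set F : ℕ → Fin (p ^ t) → ZMod p := fun k => trackWord (p ^ t) (G k) with hF
  have hFper : Function.Periodic F P := by
    intro k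
    simp only [hF]
    rw [trackWord_eq_iff t (hG1 _) (hG1 _), ← hcard, mul_comm N, hGq, mul_comm h]
    exact hperX _ _
  have hFinj : ∀ k l, k < P → l < P → F k = F l → k = l := by
    intro k l hk hl hkl
    simp only [hF] at hkl
    rw [trackWord_eq_iff t (hG1 _) (hG1 _)] at hkl
    have hmod := hu.inj _ (Nat.mod_lt k hN) _ (Nat.mod_lt l hN) ⟨_, _, hkl⟩
    simp only [hG, hmod] at hkl
    by_contra hne
    have hdiv : k / N ≠ l / N := fun h' => hne (by
      rw [← Nat.div_add_mod k N, ← Nat.div_add_mod l N, h', hmod])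
    have hh0 : h ≠ 0 := by rintro rfl; exact hph (dvd_zero p)
    obtain ⟨v, hv, hv'⟩ := exists_dvd_of_pow_dvd_shift_sub
      (fun h' => hdiv (Nat.eq_of_mul_eq_mul_left (Nat.pos_of_ne_zero hh0) h'))
      (hu.eval_one h0 _ (Nat.mod_lt l hN).le) hkl
    have htv : t + 1 ≤ v := (Nat.pow_lt_pow_iff_right hp.one_lt).1 hv'
    have hdv : ((p ^ (t + 1) : ℕ) : ℤ) ∣ ((k / N : ℕ) : ℤ) - ((l / N : ℕ) : ℤ) := by
      have h1 : ((p ^ (t + 1) : ℕ) : ℤ) ∣ (h : ℤ) * (((k / N : ℕ) : ℤ) - ((l / N : ℕ) : ℤ)) := by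
        rw [mul_sub]
        push_cast at hv ⊢
        exact (pow_dvd_pow _ htv).trans hv
      refine IsCoprime.dvd_of_dvd_mul_left ?_ h1
      rw [Nat.isCoprime_iff_coprime]
      exact Nat.Coprime.pow_left _ ((Nat.Prime.coprime_iff_not_dvd hp).2 hph)
    have hlt : ∀ k < P, k / N < p ^ (t + 1) := fun k hk =>
      (Nat.div_lt_iff_lt_mul hN).2 (by rwa [mul_comm, hcard])
    have e1 := (Nat.modEq_iff_dvd.2 hdv)
    exact hdiv (Nat.ModEq.eq_of_lt_of_lt e1 (hlt l hl) (hlt k hk)).symm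
  have hFstep : ∀ k, ∃ c : ZMod p, c ≠ 0 ∧ ∃ i : ℕ, ∀ l,
      F (k + 1) l = F k l + if (l : ℕ) = i % p ^ t then c else 0 := by
    intro k
    obtain ⟨c, hc, i, hs⟩ := hu.step (k % N) (Nat.mod_lt k hN)
    refine ⟨c, hc, h * (k / N) + i, fun l => ?_⟩
    have hkey : F (k + 1) = trackWord (p ^ t) (G k + C c * (X - 1) * X ^ (h * (k / N) + i)) := by
      simp only [hF]
      rw [trackWord_eq_iff t (hG1 _) (by simp [hG1])]
      have hR : G k + C c * (X - 1) * X ^ (h * (k / N) + i)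
          = X ^ (h * (k / N)) * u (k % N + 1) := by
        simp only [hG, hs]
        ring
      rw [hR]
      rcases (Nat.succ_le_of_lt (Nat.mod_lt k hN)).lt_or_eq with hlt | heq
      · have hk : k + 1 = (k % N + 1) + k / N * N := by
          have := Nat.div_add_mod' k N; omega
        rw [hk, hGq]
        simp only [hG, Nat.div_eq_of_lt hlt, Nat.mod_eq_of_lt hlt]
        simp
      · have hk : k + 1 = 0 + (k / N + 1) * N := by
          have := Nat.div_add_mod' k N; rw [add_mul, one_mul]; omega
        rw [show k % N + 1 = N from heq, hk, hGq]
        obtain ⟨q, hq⟩ := hclosed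
        refine ⟨-(X ^ (h * (k / N)) * q), ?_⟩
        simp only [hG, Nat.zero_div, Nat.zero_mod, mul_zero, pow_zero, one_mul, mul_add, mul_one,
          pow_add]
        linear_combination -X ^ (h * (k / N)) * hq
    rw [hkey, trackWord_add_step hn0 (hG1 k)]
  obtain ⟨h', -, hh'⟩ := Nat.exists_mul_mod_eq_one_of_coprime
    (Nat.Coprime.pow_right (t + 1) ((Nat.Prime.coprime_iff_not_dvd hp).2 hph).symm)
    (Nat.one_lt_pow (by omega) hp.one_lt)
  have hFshift : ∀ k i (hi : i < p ^ t), F (k + i * (h' * N)) ⟨i, hi⟩ = F k ⟨0, by omega⟩ := by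
    intro k i hi
    have hexp : h * (i * h') = p ^ (t + 1) * (h * h' / p ^ (t + 1) * i) + i := by
      have := Nat.div_add_mod (h * h') (p ^ (t + 1))
      rw [hh'] at this
      calc h * (i * h') = (h * h') * i := by ring
        _ = (p ^ (t + 1) * (h * h' / p ^ (t + 1)) + 1) * i := by rw [this]
        _ = _ := by ring
    have hcongr : F (k + i * (h' * N)) = trackWord (p ^ t) (X ^ i * G k) := by
      simp only [hF]
      rw [trackWord_eq_iff t (hG1 _) (by simp [hG1]), ← mul_assoc, hGq, hexp, pow_add X, mul_assoc]
      exact hperX _ _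
    rw [hcongr, trackWord_X_pow_mul (hG1 k)]
  set W : ZMod P → Fin (p ^ t) → ZMod p := fun j => F j.val with hW
  have hWcast : ∀ k : ℕ, W (k : ZMod P) = F k := fun k => by
    simp only [hW, ZMod.val_natCast]
    exact hFper.map_mod_nat k
  refine ⟨W, hP0, fun j l hjl => ?_, fun j => ?_, fun i => ?_⟩
  · exact ZMod.val_injective P (hFinj _ _ (ZMod.val_lt j) (ZMod.val_lt l) hjl)
  · obtain ⟨k, rfl⟩ := ZMod.natCast_zmod_surjective j
    obtain ⟨c, hc, i, hs⟩ := hFstep k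
    have hcast : (k : ZMod P) + 1 = ((k + 1 : ℕ) : ZMod P) := by push_cast; rfl
    rw [hcast, hWcast, hWcast]
    refine ⟨⟨i % p ^ t, Nat.mod_lt _ (by omega)⟩, by simp [hs, hc], fun l hl => ?_⟩
    by_contra hne
    exact hl (by rw [hs, if_neg fun h => hne (Fin.ext h), add_zero])
  · refine ⟨-((i * (h' * N) : ℕ) : ZMod P), fun j => ?_⟩
    obtain ⟨k, hk⟩ := ZMod.natCast_zmod_surjective (j + -((i * (h' * N) : ℕ) : ZMod P))
    have hj : j = ((k + i * (h' * N) : ℕ) : ZMod P) := by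
      rw [Nat.cast_add, hk]; ring
    rw [← hk, hj, hWcast, hWcast]
    exact hFshift k i i.isLt

end Code

theorem mainTheorem1 (p t : ℕ) (hp : p.Prime) (hodd : Odd p) (ht : 1 ≤ t) :
    (∃ W : ZMod (p ^ p ^ t) → Fin (p ^ t) → ZMod p,
      IsSingleTrackGrayCode p (p ^ t) (p ^ p ^ t) W) ∧
    (∀ W : ZMod (p ^ p ^ t) → Fin (p ^ t) → ZMod p,
      IsSingleTrackGrayCode p (p ^ t) (p ^ p ^ t) W →
        ∀ w : Fin (p ^ t) → ZMod p, ∃! j : ZMod (p ^ p ^ t), W j = w) ∧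
    (∀ (P : ℕ) (W : ZMod P → Fin (p ^ t) → ZMod p),
      IsSingleTrackGrayCode p (p ^ t) P W → P ≤ p ^ p ^ t) := by
  have : Fact p.Prime := ⟨hp⟩
  have hp2 : p ≠ 2 := by rintro rfl; exact absurd hodd (by decide)
  have hcard : Fintype.card (Fin (p ^ t) → ZMod p) = p ^ p ^ t := by simp [ZMod.card]
  refine ⟨exists_isSingleTrackGrayCode hp2 ht, fun W hW w => ?_, fun P W hW => ?_⟩
  · have : NeZero (p ^ p ^ t) := ⟨hW.period_pos.ne'⟩
    have hbij : Function.Bijective W :=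
      (Fintype.bijective_iff_injective_and_card W).2 ⟨hW.distinct, by rw [ZMod.card, hcard]⟩
    exact hbij.existsUnique w
  · have : NeZero P := ⟨hW.period_pos.ne'⟩
    have := Fintype.card_le_of_injective W hW.distinct
    rwa [ZMod.card, hcard] at this
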